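/- Let $\mu$ be a Borel probability measure on $\mathbb{C}$ supported in the unit circle, i.e. $\mu(\{z\in\mathbb{C}:|z|=1\})=1$, and let $Z_1,Z_2,\dots$ be independent complex-valued random variables on a probability space $(\Omega,\mathbb{P})$, each with law $\mu$. For $\omega\in\Omega$ and $n\ge 1$ put $P_n(\omega)(z)=(z-Z_1(\omega))\cdots(z-Z_n(\omega))$. Fix an integer $k\ge 1$. For $n\ge k+1$ let $W_{n,1}(\omega),\dots,W_{n,n-k}(\omega)$ be the zeros, counted with multiplicity, of the $k$-th derivative $P_n(\omega)^{(k)}$, and let $$\mu_n^{(k)}(\omega)=\frac1{n-k}\sum_{j=1}^{n-k}\delta_{W_{n,j}(\omega)}$$ be their empirical measure. Then for $\mathbb{P}$-almost every $\omega$, the probability measures $\mu_n^{(k)}(\omega)$ converge weakly to $\mu$ as $n\to\infty$. -/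

import Mathlib

open MeasureTheory ProbabilityTheory Filter Topology Polynomial
open scoped ENNReal

/-- The monic polynomial `P_n(z) = (z - z₁)⋯(z - zₙ)` whose zeros are the first `n` terms of the
sequence `z` (whose terms are numbered from `0`). -/
noncomputable def polyOfZeros (z : ℕ → ℂ) (n : ℕ) : ℂ[X] :=
  ∏ i ∈ Finset.range n, (X - C (z i))

/-- The zeros, counted with multiplicity, of the `k`-th derivative of `P_n`. -/
noncomputable def derivZeros (k : ℕ) (z : ℕ → ℂ) (n : ℕ) : Multiset ℂ :=
  (derivative^[k] (polyOfZeros z n)).roots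

/-- The normalized counting measure `(n - k)⁻¹ ∑ δ_w` over the zeros `w`, counted with
multiplicity, of the `k`-th derivative of `P_n`. -/
noncomputable def derivZerosMeasure (k : ℕ) (z : ℕ → ℂ) (n : ℕ) : Measure ℂ :=
  ((n - k : ℕ) : ℝ≥0∞)⁻¹ • ((derivZeros k z n).map Measure.dirac).sum

theorem natDegree_polyOfZeros (z : ℕ → ℂ) (n : ℕ) : (polyOfZeros z n).natDegree = n := by
  simp [polyOfZeros]

theorem card_derivZeros (k : ℕ) (z : ℕ → ℂ) (n : ℕ) :
    Multiset.card (derivZeros k z n) = n - k := by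
  unfold derivZeros
  rw [← (IsAlgClosed.splits (derivative^[k] (polyOfZeros z n))).natDegree_eq_card_roots]
  induction k with
  | zero => simp [natDegree_polyOfZeros]
  | succ k ih => rw [Function.iterate_succ_apply', natDegree_derivative, ih, Nat.sub_sub]

theorem sum_map_dirac_univ (s : Multiset ℂ) :
    (s.map Measure.dirac).sum Set.univ = (Multiset.card s : ℝ≥0∞) := by
  induction s using Multiset.induction_on with
  | empty => simp
  | cons a s ih => simp [ih, add_comm]

theorem isProbabilityMeasure_derivZerosMeasure (k : ℕ) (z : ℕ → ℂ) (n : ℕ) (hkn : k < n) :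
    IsProbabilityMeasure (derivZerosMeasure k z n) := by
  constructor
  have h : ((n - k : ℕ) : ℝ≥0∞) ≠ 0 := by
    exact_mod_cast (Nat.sub_pos_of_lt hkn).ne'
  rw [derivZerosMeasure, Measure.smul_apply, sum_map_dirac_univ, card_derivZeros, smul_eq_mul]
  exact ENNReal.inv_mul_cancel h (ENNReal.natCast_ne_top _)

/-- The empirical measure, for `n ≥ k + 1`, of the `n - k` zeros of the `k`-th derivative of `P_n`,
as a point of the space of Borel probability measures on `ℂ` with the topology of weak
convergence. -/
noncomputable def empiricalMeasure (k : ℕ) (z : ℕ → ℂ) (n : ℕ) (hkn : k < n) :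
    ProbabilityMeasure ℂ :=
  ⟨derivZerosMeasure k z n, isProbabilityMeasure_derivZerosMeasure k z n hkn⟩

/-!
The zeros of `P_n^{(k)}` stay in the closed unit disc (Gauss–Lucas), and each differentiation
changes the power sums of the zeros by a bounded amount: the difference of two consecutive sums
`∑ w ^ m` is `(2πi)⁻¹` times the contour integral over `|z| = 2` of `z ^ m (P'' / P' - P' / P)`, and
the bracket is the logarithmic derivative of `P' / P`. Hence by the law of large numbers the
moments `∫ w ^ m` of the empirical measures converge to those of `μ`. Since `μ` lives on the
circle, this gives weak convergence as soon as `∫ (1 - |w| ^ 2)` tends to `0`.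

A zero `w` far from the circle makes its Blaschke factor at a point `a` of the disc small, so a
lower bound `|P_n^{(k)}(a)| ≥ c n ^ (-p) |P_n(a)|` at a single point `a ≠ 0` of the open disc
already yields `∑ (1 - |w| ^ 2) = O(log n)`. Now `P_n^{(k)}(a) / P_n(a) = k! e_k(1 / (a - Z_i))`.
If the Cauchy transform `∫ 1 / (a - w) dμ(w)` is nonzero at some such `a`, the law of large
numbers and Newton's identities bound `e_k` below. Otherwise the Poisson kernel of every point of
the disc has `μ`-integral `1`, so arcs have `μ`-mass at most proportional to their length; as
`e_k` is affine in each variable, this makes `|e_k| < n ^ (-2k)` improbable, and Borel–Cantelli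
applies.
-/

open scoped ComplexConjugate

/-- The Cauchy transform `z ↦ ∑ 1 / (z - w)` of the counting measure of a multiset `s` of complex
numbers. For the roots of a polynomial `P` it is the logarithmic derivative `P' / P`. -/
noncomputable def cauchyTransform (s : Multiset ℂ) (z : ℂ) : ℂ :=
  (s.map fun w => 1 / (z - w)).sum

theorem cauchyTransform_zero (z : ℂ) : cauchyTransform 0 z = 0 := rfl

theorem cauchyTransform_cons (w : ℂ) (s : Multiset ℂ) (z : ℂ) :
    cauchyTransform (w ::ₘ s) z = 1 / (z - w) + cauchyTransform s z := by
  rw [cauchyTransform, Multiset.map_cons, Multiset.sum_cons, cauchyTransform]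

theorem cauchyTransform_roots {P : ℂ[X]} {z : ℂ} (hz : P.eval z ≠ 0) :
    cauchyTransform P.roots z = (derivative P).eval z / P.eval z :=
  ((IsAlgClosed.splits P).eval_derivative_div_eval_of_ne_zero hz).symm

theorem norm_sum_map_le_card_mul {ι E : Type*} [SeminormedAddCommGroup E] (s : Multiset ι)
    (f : ι → E) {c : ℝ} (h : ∀ i ∈ s, ‖f i‖ ≤ c) : ‖(s.map f).sum‖ ≤ Multiset.card s * c := by
  refine (norm_multiset_sum_le _).trans ?_
  have hle := Multiset.sum_le_card_nsmul ((s.map f).map norm) c (by simpa using h)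
  simpa using hle

theorem norm_one_div_sub_le {z w : ℂ} (hz : 1 < ‖z‖) (hw : ‖w‖ ≤ 1) :
    ‖1 / (z - w)‖ ≤ 1 / (‖z‖ - 1) := by
  rw [norm_div, norm_one]
  have := norm_sub_norm_le z w
  exact one_div_le_one_div_of_le (by linarith) (by linarith)

theorem norm_cauchyTransform_le {s : Multiset ℂ} (hs : ∀ w ∈ s, ‖w‖ ≤ 1) {z : ℂ} (hz : 1 < ‖z‖) :
    ‖cauchyTransform s z‖ ≤ Multiset.card s / (‖z‖ - 1) := by
  rw [← mul_one_div]
  exact norm_sum_map_le_card_mul s _ fun w hw => norm_one_div_sub_le hz (hs w hw)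

theorem one_half_le_re_div_sub {z w : ℂ} (hwz : ‖w‖ ≤ ‖z‖) (hne : z ≠ w) :
    1 / 2 ≤ (z / (z - w)).re := by
  have hpos : 0 < Complex.normSq (z - w) := Complex.normSq_pos.2 (sub_ne_zero.2 hne)
  have hsq : Complex.normSq w ≤ Complex.normSq z := by
    simpa only [Complex.normSq_eq_norm_sq] using pow_le_pow_left₀ (norm_nonneg w) hwz 2
  rw [Complex.div_re, ← add_div, le_div_iff₀ hpos]
  simp only [Complex.normSq_apply, Complex.sub_re, Complex.sub_im] at hsq ⊢
  linarith

theorem card_div_two_le_norm_mul_norm_cauchyTransform {s : Multiset ℂ} {z : ℂ}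
    (hs : ∀ w ∈ s, ‖w‖ ≤ ‖z‖ ∧ z ≠ w) :
    (Multiset.card s : ℝ) / 2 ≤ ‖z‖ * ‖cauchyTransform s z‖ := by
  have hre : (Multiset.card s : ℝ) / 2 ≤ (z * cauchyTransform s z).re := by
    induction s using Multiset.induction_on with
    | empty => simp [cauchyTransform_zero]
    | cons a s ih =>
      have ha := hs a (Multiset.mem_cons_self a s)
      have hdiv := one_half_le_re_div_sub ha.1 ha.2
      have hind := ih fun w hw => hs w (Multiset.mem_cons_of_mem hw)
      rw [cauchyTransform_cons, mul_add, mul_one_div, Complex.add_re, Multiset.card_cons]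
      push_cast
      linarith
  exact hre.trans ((Complex.re_le_norm _).trans_eq (norm_mul _ _))

theorem hasDerivAt_cauchyTransform {s : Multiset ℂ} {z : ℂ} (hs : z ∉ s) :
    HasDerivAt (cauchyTransform s) (-(s.map fun w => (1 / (z - w)) ^ 2).sum) z := by
  induction s using Multiset.induction_on with
  | empty => simpa [funext cauchyTransform_zero] using hasDerivAt_const z (0 : ℂ)
  | cons a s ih =>
    rw [Multiset.mem_cons, not_or] at hs
    have ha : HasDerivAt (fun x => 1 / (x - a)) (-(1 / (z - a)) ^ 2) z := by
      simpa [div_eq_mul_inv] using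
        ((hasDerivAt_id' z).sub_const a).fun_inv (sub_ne_zero.2 hs.1)
    simp only [funext (cauchyTransform_cons a s), Multiset.map_cons, Multiset.sum_cons, neg_add]
    exact ha.add (ih hs.2)

-- With `f = P' / P` this is the identity `P'' / P' - f = f' / f`.
theorem cauchyTransform_roots_derivative_sub {P : ℂ[X]} {z : ℂ} (h0 : P.eval z ≠ 0)
    (h1 : (derivative P).eval z ≠ 0) :
    cauchyTransform (derivative P).roots z - cauchyTransform P.roots z
      = -(P.roots.map fun w => (1 / (z - w)) ^ 2).sum / cauchyTransform P.roots z := by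
  have hroot : z ∉ P.roots := fun hz => h0 (isRoot_of_mem_roots hz)
  have hquot : HasDerivAt (fun x => (derivative P).eval x / P.eval x)
      (((derivative (derivative P)).eval z * P.eval z
        - (derivative P).eval z * (derivative P).eval z) / P.eval z ^ 2) z :=
    ((derivative P).hasDerivAt z).div (P.hasDerivAt z) h0
  have heq : (fun x => (derivative P).eval x / P.eval x) =ᶠ[𝓝 z] cauchyTransform P.roots :=
    (P.continuous.continuousAt.eventually_ne h0).mono fun x hx => (cauchyTransform_roots hx).symm
  rw [((hasDerivAt_cauchyTransform hroot).congr_of_eventuallyEq heq).unique hquot,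
    cauchyTransform_roots h0, cauchyTransform_roots h1]
  field_simp

theorem circleIntegrable_pow_mul_one_div_sub {w : ℂ} {R : ℝ} (hw : ‖w‖ < R) (m : ℕ) :
    CircleIntegrable (fun z => z ^ m * (1 / (z - w))) 0 R := by
  have hR : 0 ≤ R := (norm_nonneg w).trans hw.le
  refine ContinuousOn.circleIntegrable hR
    ((continuous_pow m).continuousOn.mul (continuousOn_const.div (by fun_prop) fun z hz => ?_))
  rw [mem_sphere_zero_iff_norm] at hz
  exact sub_ne_zero.2 fun h => (h ▸ hw).ne hz

theorem circleIntegral_pow_mul_cauchyTransform {s : Multiset ℂ} {R : ℝ} (hs : ∀ w ∈ s, ‖w‖ < R)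
    (m : ℕ) :
    CircleIntegrable (fun z => z ^ m * cauchyTransform s z) 0 R ∧
      (∮ z in C(0, R), z ^ m * cauchyTransform s z)
        = 2 * Real.pi * Complex.I * (s.map (· ^ m)).sum := by
  induction s using Multiset.induction_on with
  | empty => simp [cauchyTransform_zero, CircleIntegrable, circleIntegral]
  | cons a s ih =>
    have ha := hs a (Multiset.mem_cons_self a s)
    obtain ⟨hint, hval⟩ := ih fun w hw => hs w (Multiset.mem_cons_of_mem hw)
    have hcauchy : (∮ z in C(0, R), z ^ m * (1 / (z - a))) = 2 * Real.pi * Complex.I * a ^ m := by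
      have := DiffContOnCl.circleIntegral_sub_inv_smul (f := fun z : ℂ => z ^ m)
        (differentiable_pow m).diffContOnCl (mem_ball_zero_iff.2 ha)
      simpa [mul_comm] using this
    have hinta := circleIntegrable_pow_mul_one_div_sub ha m
    simp only [cauchyTransform_cons, mul_add, Multiset.map_cons, Multiset.sum_cons]
    exact ⟨hinta.add hint, by rw [circleIntegral.integral_add hinta hint, hcauchy, hval]⟩

theorem norm_cauchyTransform_roots_derivative_sub_le {P : ℂ[X]} (hdeg : 0 < P.natDegree)
    (hP : ∀ w ∈ P.roots, ‖w‖ ≤ 1) {z : ℂ} (hz : 1 < ‖z‖) :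
    ‖cauchyTransform (derivative P).roots z - cauchyTransform P.roots z‖
      ≤ 2 * ‖z‖ / (‖z‖ - 1) ^ 2 := by
  have hcard : (Multiset.card P.roots : ℝ) = P.natDegree := by
    rw [(IsAlgClosed.splits P).natDegree_eq_card_roots]
  have hn : (0 : ℝ) < P.natDegree := by exact_mod_cast hdeg
  have hroot : z ∉ P.roots := fun h => (hP z h).not_gt hz
  have h0 : P.eval z ≠ 0 := fun h =>
    hroot ((mem_roots (ne_zero_of_natDegree_gt hdeg)).2 h)
  have hlow := card_div_two_le_norm_mul_norm_cauchyTransform (s := P.roots) (z := z) fun w hw =>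
    ⟨(hP w hw).trans hz.le, fun h => hroot (h ▸ hw)⟩
  have hpos : 0 < ‖cauchyTransform P.roots z‖ := by
    by_contra! hle
    nlinarith [norm_nonneg z]
  have h1 : (derivative P).eval z ≠ 0 := fun h => by
    rw [cauchyTransform_roots h0, h, zero_div, norm_zero] at hpos
    exact hpos.false
  have hup : ‖(P.roots.map fun w => (1 / (z - w)) ^ 2).sum‖
      ≤ Multiset.card P.roots * (1 / (‖z‖ - 1)) ^ 2 :=
    norm_sum_map_le_card_mul _ _ fun w hw => by
      rw [norm_pow]
      exact pow_le_pow_left₀ (norm_nonneg _) (norm_one_div_sub_le hz (hP w hw)) 2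
  rw [cauchyTransform_roots_derivative_sub h0 h1, norm_div, norm_neg, div_le_iff₀ hpos]
  calc ‖(P.roots.map fun w => (1 / (z - w)) ^ 2).sum‖
      ≤ Multiset.card P.roots / 2 * (2 * (1 / (‖z‖ - 1)) ^ 2) := hup.trans_eq (by ring)
    _ ≤ ‖z‖ * ‖cauchyTransform P.roots z‖ * (2 * (1 / (‖z‖ - 1)) ^ 2) := by gcongr
    _ = 2 * ‖z‖ / (‖z‖ - 1) ^ 2 * ‖cauchyTransform P.roots z‖ := by rw [one_div_pow]; ring

theorem roots_iterate_derivative_subset_of_convex {P : ℂ[X]} {s : Set ℂ} (hs : Convex ℝ s)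
    (hP : ∀ w ∈ P.roots, w ∈ s) (k : ℕ) : ∀ w ∈ (derivative^[k] P).roots, w ∈ s := by
  induction k with
  | zero => exact hP
  | succ k ih =>
    intro w hw
    rw [Function.iterate_succ_apply'] at hw
    have hdeg : 0 < (derivative^[k] P).degree := by
      by_contra! hle
      rw [eq_C_of_degree_le_zero hle, derivative_C, roots_zero] at hw
      exact Multiset.notMem_zero w hw
    refine convexHull_min (fun v hv => ih v ?_) hs
      (rootSet_derivative_subset_convexHull_rootSet hdeg (?_ : w ∈ _))
    · simpa [rootSet] using hv
    · simpa [rootSet] using hw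

theorem natDegree_iterate_derivative_eq (P : ℂ[X]) (k : ℕ) :
    (derivative^[k] P).natDegree = P.natDegree - k := by
  induction k with
  | zero => rfl
  | succ k ih => rw [Function.iterate_succ_apply', natDegree_derivative, ih, Nat.sub_sub]

section RootsInDisc

variable {P : ℂ[X]} (hP : ∀ w ∈ P.roots, ‖w‖ ≤ 1)
include hP

theorem norm_le_one_of_mem_roots_iterate_derivative (k : ℕ) :
    ∀ w ∈ (derivative^[k] P).roots, ‖w‖ ≤ 1 := by
  simpa using roots_iterate_derivative_subset_of_convex
    (convex_closedBall (0 : ℂ) 1) (by simpa using hP) k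

theorem norm_sum_pow_roots_derivative_sub_le (hdeg : 0 < P.natDegree) (m : ℕ) :
    ‖((derivative P).roots.map (· ^ m)).sum - (P.roots.map (· ^ m)).sum‖ ≤ 8 * 2 ^ m := by
  have hlt {s : Multiset ℂ} (hs : ∀ w ∈ s, ‖w‖ ≤ 1) : ∀ w ∈ s, ‖w‖ < 2 := fun w hw =>
    (hs w hw).trans_lt one_lt_two
  have hP' : ∀ w ∈ (derivative P).roots, ‖w‖ ≤ 1 :=
    norm_le_one_of_mem_roots_iterate_derivative hP 1
  obtain ⟨hint, hval⟩ := circleIntegral_pow_mul_cauchyTransform (hlt hP) m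
  obtain ⟨hint', hval'⟩ := circleIntegral_pow_mul_cauchyTransform (hlt hP') m
  have hbound : ∀ z ∈ Metric.sphere (0 : ℂ) 2,
      ‖z ^ m * cauchyTransform (derivative P).roots z - z ^ m * cauchyTransform P.roots z‖
        ≤ 4 * 2 ^ m := fun z hz => by
    rw [mem_sphere_zero_iff_norm] at hz
    have hdiff := norm_cauchyTransform_roots_derivative_sub_le hdeg hP (z := z) (by linarith)
    rw [hz] at hdiff
    rw [← mul_sub, norm_mul, norm_pow, hz, mul_comm]
    gcongr
    exact hdiff.trans_eq (by norm_num)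
  have hle := circleIntegral.norm_two_pi_i_inv_smul_integral_le_of_norm_le_const
    zero_le_two hbound
  rw [circleIntegral.integral_sub hint' hint, hval, hval', ← mul_sub, smul_eq_mul,
    inv_mul_cancel_left₀ Complex.two_pi_I_ne_zero] at hle
  exact hle.trans_eq (by ring)

theorem norm_sum_pow_roots_iterate_derivative_sub_le {k : ℕ} (hk : k ≤ P.natDegree) (m : ℕ) :
    ‖((derivative^[k] P).roots.map (· ^ m)).sum - (P.roots.map (· ^ m)).sum‖
      ≤ k * (8 * 2 ^ m) := by
  induction k with
  | zero => simp
  | succ k ih =>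
    have hstep := norm_sum_pow_roots_derivative_sub_le
      (norm_le_one_of_mem_roots_iterate_derivative hP k)
      (by rw [natDegree_iterate_derivative_eq]; omega) m
    rw [Function.iterate_succ_apply']
    refine (norm_sub_le_norm_sub_add_norm_sub _ (((derivative^[k] P).roots.map (· ^ m)).sum)
      _).trans ?_
    push_cast
    linarith [ih (by omega)]

theorem norm_eval_derivative_le {u : ℂ} (hu : 1 < ‖u‖) :
    ‖(derivative P).eval u‖ ≤ ‖P.eval u‖ * (P.natDegree / (‖u‖ - 1)) := by
  rcases eq_or_ne P 0 with rfl | hP0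
  · simp
  have h0 : P.eval u ≠ 0 := fun h => (hP u ((mem_roots hP0).2 h)).not_gt hu
  have hlog := norm_cauchyTransform_le hP hu
  rwa [cauchyTransform_roots h0, norm_div, div_le_iff₀' (norm_pos_iff.2 h0),
    ← (IsAlgClosed.splits P).natDegree_eq_card_roots] at hlog

theorem norm_eval_iterate_derivative_le {u : ℂ} (hu : 1 < ‖u‖) (k : ℕ) :
    ‖(derivative^[k] P).eval u‖ ≤ ‖P.eval u‖ * (P.natDegree / (‖u‖ - 1)) ^ k := by
  induction k with
  | zero => simp
  | succ k ih =>
    have hdeg : ((derivative^[k] P).natDegree : ℝ) ≤ P.natDegree := by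
      exact_mod_cast (natDegree_iterate_derivative_eq P k).trans_le (Nat.sub_le _ _)
    rw [Function.iterate_succ_apply', pow_succ, ← mul_assoc]
    calc _ ≤ ‖(derivative^[k] P).eval u‖ * ((derivative^[k] P).natDegree / (‖u‖ - 1)) :=
          norm_eval_derivative_le (norm_le_one_of_mem_roots_iterate_derivative hP k) hu
      _ ≤ _ := by
        have := sub_pos.2 hu
        gcongr

end RootsInDisc

theorem norm_one_sub_conj_mul_eq {a : ℂ} (ha : a ≠ 0) (w : ℂ) :
    ‖1 - conj a * w‖ = ‖a‖ * ‖(conj a)⁻¹ - w‖ := by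
  rw [← Complex.norm_conj a, ← norm_mul, mul_sub, mul_inv_cancel₀ ((_root_.map_ne_zero _).2 ha)]

theorem norm_sub_sq_eq (a w : ℂ) :
    ‖a - w‖ ^ 2 = ‖1 - conj a * w‖ ^ 2 - (1 - ‖a‖ ^ 2) * (1 - ‖w‖ ^ 2) := by
  simp only [← Complex.normSq_eq_norm_sq, Complex.normSq_apply, Complex.sub_re, Complex.sub_im,
    Complex.mul_re, Complex.mul_im, Complex.conj_re, Complex.conj_im, Complex.one_re,
    Complex.one_im]
  ring

theorem norm_sub_eq_of_norm_eq_one {a w : ℂ} (ha : a ≠ 0) (hw : ‖w‖ = 1) :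
    ‖a - w‖ = ‖a‖ * ‖(conj a)⁻¹ - w‖ := by
  rw [← norm_one_sub_conj_mul_eq ha, ← sq_eq_sq₀ (norm_nonneg _) (norm_nonneg _), norm_sub_sq_eq,
    hw]
  ring

theorem norm_sub_le_mul_exp {a w : ℂ} (ha0 : a ≠ 0) (ha : ‖a‖ ≤ 1) (hw : ‖w‖ ≤ 1) :
    ‖a - w‖ ≤ ‖a‖ * ‖(conj a)⁻¹ - w‖ * Real.exp (-((1 - ‖a‖ ^ 2) / 8 * (1 - ‖w‖ ^ 2))) := by
  rw [← norm_one_sub_conj_mul_eq ha0]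
  set t := (1 - ‖a‖ ^ 2) / 8 * (1 - ‖w‖ ^ 2) with ht
  have ht0 : 0 ≤ t := mul_nonneg (div_nonneg (sub_nonneg.2 (pow_le_one₀ (norm_nonneg a) ha))
    (by norm_num)) (sub_nonneg.2 (pow_le_one₀ (norm_nonneg w) hw))
  have hle_two : ‖1 - conj a * w‖ ≤ 2 := by
    refine (norm_sub_le _ _).trans ?_
    rw [norm_one, norm_mul, Complex.norm_conj]
    linarith [mul_le_one₀ ha (norm_nonneg w) hw]
  refine le_of_sq_le_sq ?_ (by positivity)
  calc ‖a - w‖ ^ 2 = ‖1 - conj a * w‖ ^ 2 - 4 * (2 * t) := by rw [norm_sub_sq_eq, ht]; ring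
    _ ≤ ‖1 - conj a * w‖ ^ 2 * (1 - 2 * t) := by
        have hsq : ‖1 - conj a * w‖ ^ 2 ≤ 2 ^ 2 := by gcongr
        linarith [mul_nonneg ht0 (sub_nonneg.2 hsq)]
    _ ≤ ‖1 - conj a * w‖ ^ 2 * Real.exp (-(2 * t)) := by
        gcongr
        exact Real.one_sub_le_exp_neg _
    _ = (‖1 - conj a * w‖ * Real.exp (-t)) ^ 2 := by
        rw [mul_pow, ← Real.exp_nat_mul, Nat.cast_ofNat, mul_neg]

theorem norm_eval_eq_of_norm_roots_eq_one {P : ℂ[X]} (hP : ∀ w ∈ P.roots, ‖w‖ = 1) {a : ℂ}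
    (ha : a ≠ 0) : ‖P.eval a‖ = ‖a‖ ^ P.natDegree * ‖P.eval (conj a)⁻¹‖ := by
  have hprod : ∀ s : Multiset ℂ, (∀ w ∈ s, ‖w‖ = 1) → ‖(s.map fun w => a - w).prod‖
      = ‖a‖ ^ Multiset.card s * ‖(s.map fun w => (conj a)⁻¹ - w).prod‖ := by
    intro s
    induction s using Multiset.induction_on with
    | empty => simp
    | cons b s ih =>
      intro hs
      have hind := ih fun w hw => hs w (Multiset.mem_cons_of_mem hw)
      have hb := norm_sub_eq_of_norm_eq_one ha (hs b (Multiset.mem_cons_self b s))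
      simp only [Multiset.map_cons, Multiset.prod_cons, Multiset.card_cons, norm_mul, hb, hind]
      ring
  simp only [(IsAlgClosed.splits P).eval_eq_prod_roots, norm_mul, hprod _ hP,
    (IsAlgClosed.splits P).natDegree_eq_card_roots]
  ring

-- The Blaschke factors `(a - w) / (1 - conj a * w)` are small when `w` is far from the circle.
theorem norm_eval_le_mul_exp {P : ℂ[X]} (hP : ∀ w ∈ P.roots, ‖w‖ ≤ 1) {a : ℂ} (ha0 : a ≠ 0)
    (ha : ‖a‖ ≤ 1) :
    ‖P.eval a‖ ≤ ‖a‖ ^ P.natDegree * ‖P.eval (conj a)⁻¹‖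
      * Real.exp (-((1 - ‖a‖ ^ 2) / 8 * (P.roots.map fun w => 1 - ‖w‖ ^ 2).sum)) := by
  have hprod : ∀ s : Multiset ℂ, (∀ w ∈ s, ‖w‖ ≤ 1) → ‖(s.map fun w => a - w).prod‖
      ≤ ‖a‖ ^ Multiset.card s * ‖(s.map fun w => (conj a)⁻¹ - w).prod‖
        * Real.exp (-((1 - ‖a‖ ^ 2) / 8 * (s.map fun w => 1 - ‖w‖ ^ 2).sum)) := by
    intro s
    induction s using Multiset.induction_on with
    | empty => simp
    | cons b s ih =>
      intro hs
      have hind := ih fun w hw => hs w (Multiset.mem_cons_of_mem hw)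
      have hb := norm_sub_le_mul_exp ha0 ha (hs b (Multiset.mem_cons_self b s))
      simp only [Multiset.map_cons, Multiset.prod_cons, Multiset.card_cons, Multiset.sum_cons,
        norm_mul, mul_add, neg_add, Real.exp_add]
      exact (mul_le_mul hb hind (norm_nonneg _) (by positivity)).trans_eq (by ring)
  simp only [(IsAlgClosed.splits P).eval_eq_prod_roots, norm_mul,
    (IsAlgClosed.splits P).natDegree_eq_card_roots]
  exact (mul_le_mul_of_nonneg_left (hprod _ hP) (norm_nonneg _)).trans_eq (by ring)

section RootsOnCircle

variable {P : ℂ[X]} (hP : ∀ w ∈ P.roots, ‖w‖ = 1) {a : ℂ} (ha0 : a ≠ 0) (ha : ‖a‖ < 1)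
include hP ha0 ha

theorem norm_eval_iterate_derivative_le_mul_exp {k : ℕ} (hk : k ≤ P.natDegree) :
    ‖(derivative^[k] P).eval a‖ ≤ ‖P.eval a‖ * (P.natDegree / (1 - ‖a‖)) ^ k
      * Real.exp (-((1 - ‖a‖ ^ 2) / 8
        * ((derivative^[k] P).roots.map fun w => 1 - ‖w‖ ^ 2).sum)) := by
  have hpos : 0 < ‖a‖ := norm_pos_iff.2 ha0
  have hP1 : ∀ w ∈ P.roots, ‖w‖ ≤ 1 := fun w hw => (hP w hw).le
  have hu : ‖(conj a)⁻¹‖ = ‖a‖⁻¹ := by rw [norm_inv, Complex.norm_conj]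
  have houter := norm_eval_iterate_derivative_le hP1 (u := (conj a)⁻¹)
    (by rw [hu]; exact (one_lt_inv₀ hpos).2 ha) k
  have hsub : 0 < 1 - ‖a‖ := sub_pos.2 ha
  calc ‖(derivative^[k] P).eval a‖
      ≤ ‖a‖ ^ (P.natDegree - k) * ‖(derivative^[k] P).eval (conj a)⁻¹‖ * _ := by
        rw [← natDegree_iterate_derivative_eq]
        exact norm_eval_le_mul_exp (norm_le_one_of_mem_roots_iterate_derivative hP1 k) ha0 ha.le
    _ ≤ ‖a‖ ^ (P.natDegree - k) * (‖P.eval (conj a)⁻¹‖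
          * (P.natDegree / (‖(conj a)⁻¹‖ - 1)) ^ k) * _ := by gcongr
    _ = ‖P.eval a‖ * (P.natDegree / (1 - ‖a‖)) ^ k * _ := by
        congr 1
        have hfactor : (P.natDegree : ℝ) / (‖a‖⁻¹ - 1) = ‖a‖ * (P.natDegree / (1 - ‖a‖)) := by
          field_simp
        rw [norm_eval_eq_of_norm_roots_eq_one hP ha0, hu, hfactor, mul_pow,
          ← pow_sub_mul_pow ‖a‖ hk]
        ring

theorem sum_one_sub_sq_roots_iterate_derivative_le {k : ℕ} (hk : k < P.natDegree) {q : ℝ}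
    (hq : 0 < q) (h : ‖P.eval a‖ * q ≤ ‖(derivative^[k] P).eval a‖) :
    (1 - ‖a‖ ^ 2) / 8 * ((derivative^[k] P).roots.map fun w => 1 - ‖w‖ ^ 2).sum
      ≤ k * Real.log (P.natDegree / (1 - ‖a‖)) - Real.log q := by
  have hPa : 0 < ‖P.eval a‖ := norm_pos_iff.2 fun h0 =>
    ha.ne (hP a ((mem_roots (ne_zero_of_natDegree_gt hk)).2 h0))
  have hn : (0 : ℝ) < P.natDegree := by exact_mod_cast hk.pos
  have hpos : 0 < P.natDegree / (1 - ‖a‖) := div_pos hn (sub_pos.2 ha)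
  have hle := h.trans (norm_eval_iterate_derivative_le_mul_exp hP ha0 ha hk.le)
  rw [mul_assoc, mul_le_mul_iff_right₀ hPa] at hle
  have hlog := Real.log_le_log hq hle
  rw [Real.log_mul (pow_pos hpos k).ne' (Real.exp_pos _).ne', Real.log_pow, Real.log_exp] at hlog
  linarith

end RootsOnCircle

theorem roots_polyOfZeros (z : ℕ → ℂ) (n : ℕ) :
    (polyOfZeros z n).roots = (Finset.range n).val.map z := by
  rw [← roots_multiset_prod_X_sub_C ((Finset.range n).val.map z), Multiset.map_map]
  rfl

theorem norm_eq_one_of_mem_roots_polyOfZeros {z : ℕ → ℂ} (hz : ∀ i, ‖z i‖ = 1) (n : ℕ) :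
    ∀ w ∈ (polyOfZeros z n).roots, ‖w‖ = 1 := by
  rw [roots_polyOfZeros]
  exact fun w hw => by obtain ⟨i, -, rfl⟩ := Multiset.mem_map.1 hw; exact hz i

theorem norm_le_one_of_mem_derivZeros {z : ℕ → ℂ} (hz : ∀ i, ‖z i‖ = 1) (k n : ℕ) :
    ∀ w ∈ derivZeros k z n, ‖w‖ ≤ 1 :=
  norm_le_one_of_mem_roots_iterate_derivative
    (fun w hw => (norm_eq_one_of_mem_roots_polyOfZeros hz n w hw).le) k

theorem tendsto_average_sum_pow_derivZeros {z : ℕ → ℂ} (hz : ∀ i, ‖z i‖ = 1) (k m : ℕ) {c : ℂ}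
    (h : Tendsto (fun n : ℕ => (n : ℝ)⁻¹ • ∑ i ∈ Finset.range n, z i ^ m) atTop (𝓝 c)) :
    Tendsto (fun n : ℕ => (n : ℝ)⁻¹ • ((derivZeros k z n).map (· ^ m)).sum) atTop (𝓝 c) := by
  have hdiff : Tendsto (fun n : ℕ => (n : ℝ)⁻¹ • (((derivZeros k z n).map (· ^ m)).sum
      - ∑ i ∈ Finset.range n, z i ^ m)) atTop (𝓝 0) := by
    refine squeeze_zero_norm' ?_ (tendsto_const_div_atTop_nhds_zero_nat (k * (8 * 2 ^ m) : ℝ))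
    filter_upwards [eventually_ge_atTop k] with n hkn
    have hle := norm_sum_pow_roots_iterate_derivative_sub_le
      (fun w hw => (norm_eq_one_of_mem_roots_polyOfZeros hz n w hw).le)
      (hkn.trans_eq (natDegree_polyOfZeros z n).symm) m
    rw [roots_polyOfZeros, Multiset.map_map] at hle
    rw [norm_smul, norm_inv, Real.norm_natCast, inv_mul_eq_div]
    exact div_le_div_of_nonneg_right hle n.cast_nonneg
  simpa only [← smul_add, sub_add_cancel, zero_add] using hdiff.add h

theorem tendsto_average_one_sub_sq_derivZeros {z : ℕ → ℂ} (hz : ∀ i, ‖z i‖ = 1) {a : ℂ}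
    (ha0 : a ≠ 0) (ha : ‖a‖ < 1) {k p : ℕ} {c : ℝ} (hc : 0 < c)
    (h : ∀ᶠ n : ℕ in atTop, ‖(polyOfZeros z n).eval a‖ * (c / n ^ p)
      ≤ ‖(derivative^[k] (polyOfZeros z n)).eval a‖) :
    Tendsto (fun n : ℕ => (n : ℝ)⁻¹ * ((derivZeros k z n).map fun w => 1 - ‖w‖ ^ 2).sum)
      atTop (𝓝 0) := by
  have hsub : 0 < 1 - ‖a‖ := sub_pos.2 ha
  set κ := (1 - ‖a‖ ^ 2) / 8
  have hκ : 0 < κ := by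
    have := pow_lt_one₀ (norm_nonneg a) ha two_ne_zero
    exact div_pos (sub_pos.2 this) (by norm_num)
  set C := k * Real.log (1 - ‖a‖) + Real.log c
  have hlog : Tendsto (fun n : ℕ => Real.log n / n) atTop (𝓝 0) :=
    Real.isLittleO_log_id_atTop.tendsto_div_nhds_zero.comp tendsto_natCast_atTop_atTop
  have hbound : Tendsto (fun n : ℕ => κ⁻¹ * ((k + p) * (Real.log n / n) - C / n))
      atTop (𝓝 0) := by
    simpa using ((hlog.const_mul (k + p : ℝ)).sub
      (tendsto_const_div_atTop_nhds_zero_nat C)).const_mul κ⁻¹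
  have hnonneg (n : ℕ) : 0 ≤ ((derivZeros k z n).map fun w => 1 - ‖w‖ ^ 2).sum := by
    refine Multiset.sum_nonneg fun x hx => ?_
    obtain ⟨w, hw, rfl⟩ := Multiset.mem_map.1 hx
    exact sub_nonneg.2 (pow_le_one₀ (norm_nonneg w) (norm_le_one_of_mem_derivZeros hz k n w hw))
  refine squeeze_zero' (.of_forall fun n => mul_nonneg (by positivity) (hnonneg n)) ?_ hbound
  filter_upwards [h, eventually_gt_atTop k] with n hn hkn
  have hnpos : (0 : ℝ) < n := by exact_mod_cast hkn.pos
  have hle := sum_one_sub_sq_roots_iterate_derivative_le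
    (norm_eq_one_of_mem_roots_polyOfZeros hz n) ha0 ha
    (hkn.trans_eq (natDegree_polyOfZeros z n).symm) (by positivity) hn
  rw [natDegree_polyOfZeros, Real.log_div hnpos.ne' hsub.ne', Real.log_div hc.ne' (by positivity),
    Real.log_pow, ← le_div_iff₀' hκ] at hle
  calc (n : ℝ)⁻¹ * ((derivZeros k z n).map fun w => 1 - ‖w‖ ^ 2).sum
      ≤ (n : ℝ)⁻¹ * _ := mul_le_mul_of_nonneg_left hle (by positivity)
    _ = κ⁻¹ * ((k + p) * (Real.log n / n) - C / n) := by ring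

theorem exists_mem_starSubalgebra_near_of_isCompact_of_separatesPoints {𝕜 X : Type*} [RCLike 𝕜]
    [TopologicalSpace X] {A : StarSubalgebra 𝕜 C(X, 𝕜)} (hA : A.SeparatesPoints) (f : C(X, 𝕜))
    {K : Set X} (hK : IsCompact K) {ε : ℝ} (hε : 0 < ε) :
    ∃ g ∈ A, ∀ x ∈ K, ‖f x - g x‖ < ε := by
  have : CompactSpace K := isCompact_iff_compactSpace.1 hK
  let restrictK : C(X, 𝕜) →⋆ₐ[𝕜] C(K, 𝕜) :=
    ContinuousMap.compStarAlgHom' 𝕜 𝕜 ⟨Subtype.val, continuous_subtype_val⟩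
  have hsep : (A.map restrictK).SeparatesPoints := by
    intro x y hxy
    obtain ⟨_, ⟨g, hgA, rfl⟩, hg⟩ := hA (Subtype.coe_ne_coe.2 hxy)
    exact ⟨restrictK g, ⟨restrictK g, ⟨g, hgA, rfl⟩, rfl⟩, hg⟩
  have hclosure : restrictK f ∈ closure (A.map restrictK : Set C(K, 𝕜)) := by
    rw [← StarSubalgebra.topologicalClosure_coe,
      ContinuousMap.starSubalgebra_topologicalClosure_eq_top_of_separatesPoints _ hsep]
    trivial
  obtain ⟨_, ⟨g, hgA, rfl⟩, hdist⟩ := Metric.mem_closure_iff.1 hclosure ε hε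
  refine ⟨g, hgA, fun x hx => ?_⟩
  rw [← dist_eq_norm]
  exact (ContinuousMap.dist_apply_le_dist (f := restrictK f) (g := restrictK g) ⟨x, hx⟩).trans_lt
    hdist

section CompactSupport

variable {X : Type*} [TopologicalSpace X] [MeasurableSpace X] [OpensMeasurableSpace X] {K : Set X}
  (hK : IsCompact K)
include hK

theorem integrable_of_continuous_of_ae_mem_isCompact {E : Type*} [NormedAddCommGroup E]
    [SecondCountableTopology E] {ν : Measure X} [IsFiniteMeasure ν] (hν : ∀ᵐ x ∂ν, x ∈ K)
    {f : X → E} (hf : Continuous f) : Integrable f ν := by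
  obtain ⟨C, hC⟩ := hK.exists_bound_of_continuousOn hf.continuousOn
  exact Integrable.of_bound hf.aestronglyMeasurable C (hν.mono hC)

theorem dist_integral_le_of_ae_mem_isCompact {ν : Measure X} [IsProbabilityMeasure ν]
    (hν : ∀ᵐ x ∂ν, x ∈ K) {f g : C(X, ℂ)} {ε : ℝ} (hfg : ∀ x ∈ K, ‖f x - g x‖ ≤ ε) :
    dist (∫ x, f x ∂ν) (∫ x, g x ∂ν) ≤ ε := by
  rw [dist_eq_norm, ← integral_sub
    (integrable_of_continuous_of_ae_mem_isCompact hK hν f.continuous)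
    (integrable_of_continuous_of_ae_mem_isCompact hK hν g.continuous)]
  simpa using norm_integral_le_of_norm_le_const (hν.mono hfg)

theorem tendsto_probabilityMeasure_of_starSubalgebra {ι : Type*} {l : Filter ι}
    {ν : ι → ProbabilityMeasure X} {μ : ProbabilityMeasure X}
    (hν : ∀ i, ∀ᵐ x ∂(ν i : Measure X), x ∈ K) (hμ : ∀ᵐ x ∂(μ : Measure X), x ∈ K)
    {A : StarSubalgebra ℂ C(X, ℂ)} (hA : A.SeparatesPoints)
    (h : ∀ g ∈ A, Tendsto (fun i => ∫ x, g x ∂(ν i : Measure X)) l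
      (𝓝 (∫ x, g x ∂(μ : Measure X)))) :
    Tendsto ν l (𝓝 μ) := by
  rw [ProbabilityMeasure.tendsto_iff_forall_integral_rclike_tendsto ℂ]
  intro f
  rw [Metric.tendsto_nhds]
  intro ε hε
  obtain ⟨g, hgA, hfg⟩ := exists_mem_starSubalgebra_near_of_isCompact_of_separatesPoints hA
    f.toContinuousMap hK (show 0 < ε / 3 by positivity)
  have hclose {ρ : ProbabilityMeasure X} (hρ : ∀ᵐ x ∂(ρ : Measure X), x ∈ K) :
      dist (∫ x, f x ∂(ρ : Measure X)) (∫ x, g x ∂(ρ : Measure X)) ≤ ε / 3 :=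
    dist_integral_le_of_ae_mem_isCompact hK hρ (f := f.toContinuousMap) fun x hx => (hfg x hx).le
  filter_upwards [Metric.tendsto_nhds.1 (h g hgA) (ε / 3) (by positivity)] with i hi
  have htri := dist_triangle4_right (∫ x, f x ∂(ν i : Measure X)) (∫ x, f x ∂(μ : Measure X))
    (∫ x, g x ∂(ν i : Measure X)) (∫ x, g x ∂(μ : Measure X))
  linarith [hclose (hν i), hclose hμ]

end CompactSupport

section Moments

variable {ι : Type*} {l : Filter ι} {ν : ι → ProbabilityMeasure ℂ} {μ : ProbabilityMeasure ℂ}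

theorem tendsto_probabilityMeasure_of_mixed_moments {K : Set ℂ} (hK : IsCompact K)
    (hν : ∀ i, ∀ᵐ w ∂(ν i : Measure ℂ), w ∈ K) (hμ : ∀ᵐ w ∂(μ : Measure ℂ), w ∈ K)
    (h : ∀ a b : ℕ, Tendsto (fun i => ∫ w, w ^ a * conj w ^ b ∂(ν i : Measure ℂ)) l
      (𝓝 (∫ w, w ^ a * conj w ^ b ∂(μ : Measure ℂ)))) :
    Tendsto ν l (𝓝 μ) := by
  let idC : C(ℂ, ℂ) := ContinuousMap.id ℂ
  have hspan : ∀ g ∈ Submodule.span ℂ (Submonoid.closure {idC, star idC} : Set C(ℂ, ℂ)),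
      Tendsto (fun i => ∫ w, g w ∂(ν i : Measure ℂ)) l (𝓝 (∫ w, g w ∂(μ : Measure ℂ))) := by
    intro g hg
    induction hg using Submodule.span_induction with
    | mem g hg =>
      obtain ⟨a, b, rfl⟩ := (Submonoid.mem_closure_pair _ _ _).1 hg
      exact h a b
    | zero => simpa using tendsto_const_nhds
    | add g₁ g₂ _ _ h₁ h₂ =>
      have hint {ρ : ProbabilityMeasure ℂ} (hρ : ∀ᵐ w ∂(ρ : Measure ℂ), w ∈ K) (g : C(ℂ, ℂ)) :=
        integrable_of_continuous_of_ae_mem_isCompact hK hρ g.continuous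
      simp only [ContinuousMap.add_apply, integral_add (hint (hν _) g₁) (hint (hν _) g₂),
        integral_add (hint hμ g₁) (hint hμ g₂)]
      exact h₁.add h₂
    | smul r g _ hg =>
      simpa only [ContinuousMap.smul_apply, integral_smul] using hg.const_smul r
  refine tendsto_probabilityMeasure_of_starSubalgebra hK hν hμ
    (A := StarAlgebra.adjoin ℂ {idC}) (fun x y hxy => ?_) fun g hg => hspan g ?_
  · exact ⟨idC, ⟨idC, StarAlgebra.self_mem_adjoin_singleton ℂ idC, rfl⟩, hxy⟩
  · rwa [← Algebra.adjoin_eq_span, Subalgebra.mem_toSubmodule, ← Set.singleton_union,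
      ← Set.star_singleton, ← StarAlgebra.adjoin_toSubalgebra, StarSubalgebra.mem_toSubalgebra]

theorem norm_pow_add_mul_conj_pow_sub_le {w : ℂ} (hw : ‖w‖ ≤ 1) (d b : ℕ) :
    ‖w ^ (d + b) * conj w ^ b - w ^ d‖ ≤ b * (1 - ‖w‖ ^ 2) := by
  have hfactor : w ^ (d + b) * conj w ^ b - w ^ d = w ^ d * (((‖w‖ ^ 2) ^ b - 1 : ℝ) : ℂ) := by
    push_cast
    rw [pow_add, mul_assoc, ← mul_pow, Complex.mul_conj']
    ring
  have hle_one : (‖w‖ ^ 2) ^ b ≤ 1 := pow_le_one₀ (by positivity) (pow_le_one₀ (norm_nonneg w) hw)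
  have hbernoulli : 1 + b * (‖w‖ ^ 2 - 1) ≤ (‖w‖ ^ 2) ^ b := by
    simpa using one_add_mul_le_pow (by linarith [sq_nonneg ‖w‖] : -2 ≤ ‖w‖ ^ 2 - 1) b
  rw [hfactor, norm_mul, norm_pow, Complex.norm_real, Real.norm_eq_abs, abs_sub_comm,
    abs_of_nonneg (sub_nonneg.2 hle_one)]
  refine (mul_le_of_le_one_left (sub_nonneg.2 hle_one)
    (pow_le_one₀ (norm_nonneg w) hw)).trans ?_
  linarith

section ConcentrateOnCircle

variable (hμ : ∀ᵐ w ∂(μ : Measure ℂ), ‖w‖ = 1) (hν : ∀ i, ∀ᵐ w ∂(ν i : Measure ℂ), ‖w‖ ≤ 1)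
  (hmom : ∀ m : ℕ, Tendsto (fun i => ∫ w, w ^ m ∂(ν i : Measure ℂ)) l
    (𝓝 (∫ w, w ^ m ∂(μ : Measure ℂ))))
  (hsq : Tendsto (fun i => ∫ w, (1 - ‖w‖ ^ 2) ∂(ν i : Measure ℂ)) l (𝓝 0))
include hμ hν hmom hsq

theorem tendsto_integral_pow_add_mul_conj_pow (d b : ℕ) :
    Tendsto (fun i => ∫ w, w ^ (d + b) * conj w ^ b ∂(ν i : Measure ℂ)) l
      (𝓝 (∫ w, w ^ (d + b) * conj w ^ b ∂(μ : Measure ℂ))) := by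
  have hlimit : ∫ w, w ^ (d + b) * conj w ^ b ∂(μ : Measure ℂ) = ∫ w, w ^ d ∂(μ : Measure ℂ) := by
    refine integral_congr_ae (hμ.mono fun w hw => sub_eq_zero.1 (norm_le_zero_iff.1 ?_))
    simpa [hw] using norm_pow_add_mul_conj_pow_sub_le hw.le d b
  have hint (i : ι) {E : Type} [NormedAddCommGroup E] [SecondCountableTopology E] {f : ℂ → E}
      (hf : Continuous f) : Integrable f (ν i : Measure ℂ) :=
    integrable_of_continuous_of_ae_mem_isCompact (isCompact_closedBall (0 : ℂ) 1)
      ((hν i).mono fun w hw => mem_closedBall_zero_iff.2 hw) hf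
  have hdiff : Tendsto (fun i => (∫ w, w ^ (d + b) * conj w ^ b ∂(ν i : Measure ℂ))
      - ∫ w, w ^ d ∂(ν i : Measure ℂ)) l (𝓝 0) := by
    refine squeeze_zero_norm (fun i => ?_) (by simpa using hsq.const_mul (b : ℝ))
    rw [← integral_sub (hint i (by fun_prop)) (hint i (by fun_prop)), ← integral_const_mul]
    exact norm_integral_le_of_norm_le (hint i (by fun_prop))
      ((hν i).mono fun w hw => norm_pow_add_mul_conj_pow_sub_le hw d b)
  rw [hlimit]
  simpa only [sub_add_cancel, zero_add] using hdiff.add (hmom d)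

theorem tendsto_probabilityMeasure_of_moments : Tendsto ν l (𝓝 μ) := by
  have hconj (ρ : Measure ℂ) (a b : ℕ) :
      conj (∫ w, w ^ a * conj w ^ b ∂ρ) = ∫ w, w ^ b * conj w ^ a ∂ρ := by
    rw [← integral_conj]
    simp only [map_mul, map_pow, Complex.conj_conj, mul_comm]
  refine tendsto_probabilityMeasure_of_mixed_moments (isCompact_closedBall (0 : ℂ) 1)
    (fun i => (hν i).mono fun w hw => mem_closedBall_zero_iff.2 hw)
    (hμ.mono fun w hw => mem_closedBall_zero_iff.2 hw.le) fun a b => ?_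
  rcases le_total b a with hab | hab
  · obtain ⟨d, rfl⟩ := Nat.exists_eq_add_of_le' hab
    exact tendsto_integral_pow_add_mul_conj_pow hμ hν hmom hsq d b
  · obtain ⟨d, rfl⟩ := Nat.exists_eq_add_of_le' hab
    simpa only [Function.comp_def, hconj] using (Complex.continuous_conj.tendsto _).comp
      (tendsto_integral_pow_add_mul_conj_pow hμ hν hmom hsq d a)

end ConcentrateOnCircle

end Moments

section SumDirac

variable {X : Type*} [MeasurableSpace X]

theorem integrable_sum_map_dirac [TopologicalSpace X] [OpensMeasurableSpace X]
    {E : Type*} [NormedAddCommGroup E] [SecondCountableTopology E] {f : X → E} (hf : Continuous f)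
    (s : Multiset X) :
    Integrable f (s.map Measure.dirac).sum := by
  induction s using Multiset.induction_on with
  | empty => simp
  | cons a s ih =>
    rw [Multiset.map_cons, Multiset.sum_cons]
    exact (integrable_dirac' hf.stronglyMeasurable (by simp)).add_measure ih

theorem integral_sum_map_dirac [TopologicalSpace X] [OpensMeasurableSpace X]
    {E : Type*} [NormedAddCommGroup E] [NormedSpace ℝ E] [SecondCountableTopology E]
    [CompleteSpace E] {f : X → E} (hf : Continuous f) (s : Multiset X) :
    ∫ w, f w ∂(s.map Measure.dirac).sum = (s.map f).sum := by
  induction s using Multiset.induction_on with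
  | empty => simp
  | cons a s ih =>
    simp only [Multiset.map_cons, Multiset.sum_cons]
    rw [integral_add_measure (integrable_dirac' hf.stronglyMeasurable (by simp))
      (integrable_sum_map_dirac hf s), ih, integral_dirac' f a hf.stronglyMeasurable]

theorem ae_sum_map_dirac {p : X → Prop} (hp : MeasurableSet {w | p w}) {s : Multiset X}
    (h : ∀ w ∈ s, p w) : ∀ᵐ w ∂(s.map Measure.dirac).sum, p w := by
  induction s using Multiset.induction_on with
  | empty => simp
  | cons a s ih =>
    rw [Multiset.map_cons, Multiset.sum_cons, ae_add_measure_iff]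
    exact ⟨(ae_dirac_iff hp).2 (h a (Multiset.mem_cons_self a s)),
      ih fun w hw => h w (Multiset.mem_cons_of_mem hw)⟩

end SumDirac

theorem integral_empiricalMeasure {E : Type*} [NormedAddCommGroup E] [NormedSpace ℝ E]
    [SecondCountableTopology E] [CompleteSpace E] {f : ℂ → E} (hf : Continuous f) {k n : ℕ}
    (hkn : k < n) (z : ℕ → ℂ) :
    ∫ w, f w ∂(empiricalMeasure k z n hkn : Measure ℂ)
      = ((n - k : ℕ) : ℝ)⁻¹ • ((derivZeros k z n).map f).sum := by
  change ∫ w, f w ∂(derivZerosMeasure k z n) = _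
  rw [derivZerosMeasure, integral_smul_measure, integral_sum_map_dirac hf, ENNReal.toReal_inv,
    ENNReal.toReal_natCast]

theorem tendsto_inv_natCast_sub_smul {E : Type*} [NormedAddCommGroup E] [NormedSpace ℝ E]
    {x : ℕ → E} {L : E} (h : Tendsto (fun n : ℕ => (n : ℝ)⁻¹ • x n) atTop (𝓝 L)) (k : ℕ) :
    Tendsto (fun n : ℕ => ((n - k : ℕ) : ℝ)⁻¹ • x n) atTop (𝓝 L) := by
  have hratio : Tendsto (fun n : ℕ => (n : ℝ) / ((n - k : ℕ) : ℝ)) atTop (𝓝 1) := by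
    rw [← tendsto_add_atTop_iff_nat k]
    simpa using (tendsto_natCast_div_add_atTop (k : ℝ)).inv₀ one_ne_zero
  have hmul := hratio.smul h
  rw [one_smul] at hmul
  refine hmul.congr' ?_
  filter_upwards [eventually_ne_atTop 0] with n hn
  rw [smul_smul, div_mul_eq_mul_div, mul_inv_cancel₀ (Nat.cast_ne_zero.2 hn), one_div]

theorem tendsto_empiricalMeasure {z : ℕ → ℂ} (hz : ∀ i, ‖z i‖ = 1) {μ : ProbabilityMeasure ℂ}
    (hμ : ∀ᵐ w ∂(μ : Measure ℂ), ‖w‖ = 1)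
    (hmom : ∀ m : ℕ, Tendsto (fun n : ℕ => (n : ℝ)⁻¹ • ∑ i ∈ Finset.range n, z i ^ m) atTop
      (𝓝 (∫ w, w ^ m ∂(μ : Measure ℂ))))
    {a : ℂ} (ha0 : a ≠ 0) (ha : ‖a‖ < 1) {k p : ℕ} {c : ℝ} (hc : 0 < c)
    (hlower : ∀ᶠ n : ℕ in atTop, ‖(polyOfZeros z n).eval a‖ * (c / n ^ p)
      ≤ ‖(derivative^[k] (polyOfZeros z n)).eval a‖)
    {ι : Type*} {l : Filter ι} {u : ι → ℕ} (hu : Tendsto u l atTop) (hku : ∀ i, k < u i) :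
    Tendsto (fun i => empiricalMeasure k z (u i) (hku i)) l (𝓝 μ) := by
  refine tendsto_probabilityMeasure_of_moments hμ (fun i => ?_) (fun d => ?_) ?_
  · exact Measure.ae_smul_measure (ae_sum_map_dirac
      (measurableSet_le measurable_norm measurable_const)
      (norm_le_one_of_mem_derivZeros hz k _)) _
  · simp only [integral_empiricalMeasure (continuous_pow d)]
    exact (tendsto_inv_natCast_sub_smul
      (tendsto_average_sum_pow_derivZeros hz k d (hmom d)) k).comp hu
  · have hcont : Continuous fun w : ℂ => 1 - ‖w‖ ^ 2 := by fun_prop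
    simp only [integral_empiricalMeasure hcont]
    exact (tendsto_inv_natCast_sub_smul
      (tendsto_average_one_sub_sq_derivZeros hz ha0 ha hc hlower) k).comp hu

section Esymm

variable {R : Type*} [CommRing R]

theorem esymm_zero_right (s : Multiset R) : s.esymm 0 = 1 := by
  simp [Multiset.esymm]

theorem esymm_zero_succ (k : ℕ) : (0 : Multiset R).esymm (k + 1) = 0 := by
  rw [Multiset.esymm, Multiset.powersetCard_zero_right, Multiset.map_zero, Multiset.sum_zero]

theorem esymm_cons_succ (a : R) (s : Multiset R) (k : ℕ) :
    (a ::ₘ s).esymm (k + 1) = s.esymm (k + 1) + a * s.esymm k := by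
  simp [Multiset.esymm, Multiset.map_map, Multiset.sum_map_mul_left]

theorem iterate_derivative_mul_X_sub_C (p : R[X]) (c : R) (k : ℕ) :
    derivative^[k + 1] (p * (X - C c))
      = derivative^[k + 1] p * (X - C c) + ((k : R[X]) + 1) * derivative^[k] p := by
  rw [mul_sub, iterate_derivative_sub, iterate_derivative_mul_X, mul_comm p (C c),
    iterate_derivative_C_mul, nsmul_eq_mul, Nat.add_sub_cancel]
  push_cast
  ring

theorem eval_iterate_derivative_prod_X_sub_C {F : Type*} [Field F] {s : Multiset F} {a : F}
    (ha : a ∉ s) (k : ℕ) :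
    (derivative^[k] (s.map fun w => X - C w).prod).eval a
      = (s.map fun w => X - C w).prod.eval a
        * (k.factorial * (s.map fun w => 1 / (a - w)).esymm k) := by
  induction s using Multiset.induction_on generalizing k with
  | empty =>
    cases k with
    | zero => simp [esymm_zero_right]
    | succ k => simp [esymm_zero_succ]
  | cons w s ih =>
    rw [Multiset.mem_cons, not_or] at ha
    have haw : a - w ≠ 0 := sub_ne_zero.2 ha.1
    cases k with
    | zero => simp [esymm_zero_right]
    | succ k =>
      rw [Multiset.map_cons, Multiset.prod_cons, mul_comm (X - C w),
        iterate_derivative_mul_X_sub_C, Multiset.map_cons, esymm_cons_succ, Nat.factorial_succ]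
      simp only [eval_add, eval_mul, eval_sub, eval_X, eval_C, eval_natCast, eval_one,
        ih ha.2, Nat.factorial_succ]
      push_cast
      field_simp

/-- The elementary symmetric function `e_k` of the first `n` terms of a sequence. -/
noncomputable def esymmRange (x : ℕ → R) (n k : ℕ) : R :=
  ((Multiset.range n).map x).esymm k

theorem esymmRange_zero_right (x : ℕ → R) (n : ℕ) : esymmRange x n 0 = 1 :=
  esymm_zero_right _

theorem esymmRange_succ_succ (x : ℕ → R) (n k : ℕ) :
    esymmRange x (n + 1) (k + 1) = esymmRange x n (k + 1) + x n * esymmRange x n k := by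
  simp only [esymmRange, Multiset.range_succ, Multiset.map_cons, esymm_cons_succ]

theorem dependsOn_esymmRange (n k : ℕ) :
    DependsOn (fun x : ℕ → R => esymmRange x n k) (Finset.range n) := fun _ _ h =>
  congrArg (Multiset.esymm · k) (Multiset.map_congr rfl fun i hi =>
    h i (Finset.mem_coe.2 (Finset.mem_range.2 (Multiset.mem_range.1 hi))))

theorem continuous_esymmRange [TopologicalSpace R] [IsTopologicalRing R] (n k : ℕ) :
    Continuous fun x : ℕ → R => esymmRange x n k := by
  simp only [esymmRange, ← Finset.range_val, Finset.esymm_map_val]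
  fun_prop

theorem succ_mul_esymmRange_succ (x : ℕ → R) (n k : ℕ) :
    (k + 1) * esymmRange x n (k + 1)
      = ∑ j ∈ Finset.range (k + 1),
          (-1) ^ j * esymmRange x n (k - j) * ∑ i ∈ Finset.range n, x i ^ (j + 1) := by
  have hesymm (j : ℕ) : MvPolynomial.aeval (fun i : Fin n => x i)
      (MvPolynomial.esymm (Fin n) ℤ j) = esymmRange x n j := by
    rw [MvPolynomial.aeval_esymm_eq_multiset_esymm, esymmRange, ← Finset.range_val,
      ← Nat.Iio_eq_range, ← Fin.map_valEmbedding_univ, Finset.map_val, Multiset.map_map]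
    rfl
  have hpsum (j : ℕ) : MvPolynomial.aeval (fun i : Fin n => x i)
      (MvPolynomial.psum (Fin n) ℤ j) = ∑ i ∈ Finset.range n, x i ^ j := by
    simp [MvPolynomial.psum, Finset.sum_range]
  have hnewton := congrArg (MvPolynomial.aeval fun i : Fin n => x i)
    (MvPolynomial.mul_esymm_eq_sum (Fin n) ℤ (k + 1))
  simp only [map_mul, map_sum, map_pow, map_neg, map_one, map_natCast, hesymm, hpsum]
    at hnewton
  rw [Finset.sum_filter, Finset.Nat.sum_antidiagonal_succ', if_neg (lt_irrefl _), zero_add,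
    ← Finset.Nat.sum_antidiagonal_swap, Finset.Nat.sum_antidiagonal_eq_sum_range_succ_mk]
    at hnewton
  push_cast at hnewton
  rw [hnewton, Finset.mul_sum]
  refine Finset.sum_congr rfl fun j hj => ?_
  have hjk : j ≤ k := Finset.mem_range_succ_iff.1 hj
  have hsign : (-1 : R) ^ (k + 1 + 1) * (-1) ^ (k - j) = (-1) ^ j := by
    rw [← pow_add, show k + 1 + 1 + (k - j) = j + 2 * (k - j + 1) by omega, pow_add, pow_mul,
      neg_one_sq, one_pow, mul_one]
  simp only [Prod.fst_swap, Prod.snd_swap]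
  rw [if_pos (by omega), ← hsign]
  ring

theorem esymmRange_succ_div_pow {F : Type*} [Field F] [CharZero F] (x : ℕ → F) (n k : ℕ) (d : F) :
    esymmRange x n (k + 1) / d ^ (k + 1)
      = (∑ j ∈ Finset.range (k + 1), (-1) ^ j * (esymmRange x n (k - j) / d ^ (k - j))
          * ((∑ i ∈ Finset.range n, x i ^ (j + 1)) / d ^ (j + 1))) / (k + 1) := by
  rw [eq_div_iff (Nat.cast_add_one_ne_zero k), div_mul_eq_mul_div, mul_comm,
    succ_mul_esymmRange_succ, Finset.sum_div]
  refine Finset.sum_congr rfl fun j hj => ?_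
  have hjk : d ^ (k + 1) = d ^ (k - j) * d ^ (j + 1) := by
    rw [← pow_add, ← add_assoc, Nat.sub_add_cancel (Finset.mem_range_succ_iff.1 hj)]
  rw [hjk, mul_div_mul_comm, mul_div_assoc]

end Esymm

section BoundedTerms

variable {𝕜 : Type*} [RCLike 𝕜] {x : ℕ → 𝕜} {M : ℝ} (hx : ∀ i, ‖x i‖ ≤ M)
include hx

theorem tendsto_sum_pow_div_pow_zero {j : ℕ} (hj : 2 ≤ j) :
    Tendsto (fun n : ℕ => (∑ i ∈ Finset.range n, x i ^ j) / (n : 𝕜) ^ j) atTop (𝓝 0) := by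
  have hlim : Tendsto (fun n : ℕ => M ^ j * (n : ℝ)⁻¹) atTop (𝓝 0) := by
    simpa only [mul_zero] using tendsto_inv_atTop_nhds_zero_nat.const_mul (M ^ j)
  refine squeeze_zero_norm' ?_ hlim
  filter_upwards [eventually_ge_atTop 1] with n hn
  have hn1 : (1 : ℝ) ≤ n := by exact_mod_cast hn
  have hM : 0 ≤ M := (norm_nonneg _).trans (hx 0)
  have hsum : ‖∑ i ∈ Finset.range n, x i ^ j‖ ≤ n * M ^ j := by
    refine (norm_sum_le_of_le _ fun i _ => ?_).trans_eq (Finset.sum_const (M ^ j)) |>.trans_eq ?_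
    · exact (norm_pow _ _).trans_le (pow_le_pow_left₀ (norm_nonneg _) (hx i) j)
    · rw [Finset.card_range, nsmul_eq_mul]
  rw [norm_div, norm_pow, RCLike.norm_natCast]
  calc ‖∑ i ∈ Finset.range n, x i ^ j‖ / (n : ℝ) ^ j ≤ n * M ^ j / (n : ℝ) ^ 2 := by gcongr
    _ = M ^ j * (n : ℝ)⁻¹ := by field_simp

theorem tendsto_esymmRange_div_pow {c : 𝕜}
    (hc : Tendsto (fun n : ℕ => (n : ℝ)⁻¹ • ∑ i ∈ Finset.range n, x i) atTop (𝓝 c)) (k : ℕ) :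
    Tendsto (fun n : ℕ => esymmRange x n k / (n : 𝕜) ^ k) atTop (𝓝 (c ^ k / k.factorial)) := by
  induction k using Nat.strong_induction_on with
  | _ k ih =>
  cases k with
  | zero => simp [esymmRange_zero_right]
  | succ k =>
    have hpsum : Tendsto (fun n : ℕ => (∑ i ∈ Finset.range n, x i ^ 1) / (n : 𝕜) ^ 1) atTop
        (𝓝 c) := by
      simpa [div_eq_inv_mul, RCLike.real_smul_eq_coe_mul] using hc
    have hsmall : Tendsto (fun n : ℕ => ∑ j ∈ Finset.range k, (-1) ^ (j + 1)
        * (esymmRange x n (k - (j + 1)) / (n : 𝕜) ^ (k - (j + 1)))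
        * ((∑ i ∈ Finset.range n, x i ^ (j + 1 + 1)) / (n : 𝕜) ^ (j + 1 + 1))) atTop (𝓝 0) := by
      rw [← Finset.sum_const_zero (s := Finset.range k)]
      refine tendsto_finsetSum _ fun j _ => ?_
      simpa only [mul_zero] using ((ih (k - (j + 1)) (by omega)).const_mul ((-1) ^ (j + 1))).mul
        (tendsto_sum_pow_div_pow_zero hx (by omega))
    have hlim := (hsmall.add ((ih k (by omega)).mul hpsum)).div_const ((k : 𝕜) + 1)
    rw [zero_add] at hlim
    have hk : (k : 𝕜) + 1 ≠ 0 := Nat.cast_add_one_ne_zero k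
    have hval : c ^ k / k.factorial * c / (k + 1) = c ^ (k + 1) / (k + 1).factorial := by
      rw [Nat.factorial_succ, Nat.cast_mul, Nat.cast_add_one, pow_succ]
      field_simp
    rw [hval] at hlim
    refine hlim.congr fun n => ?_
    rw [esymmRange_succ_div_pow, Finset.sum_range_succ', pow_zero, one_mul, Nat.sub_zero, zero_add]

end BoundedTerms

theorem le_norm_eval_iterate_derivative_polyOfZeros {z : ℕ → ℂ} {a : ℂ} (hz : ∀ i, z i ≠ a)
    {n k : ℕ} {δ : ℝ} (hδ : δ ≤ ‖esymmRange (fun i => 1 / (a - z i)) n k‖) :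
    ‖(polyOfZeros z n).eval a‖ * δ ≤ ‖(derivative^[k] (polyOfZeros z n)).eval a‖ := by
  have hroots : a ∉ (Multiset.range n).map z := fun h => by
    obtain ⟨i, -, hi⟩ := Multiset.mem_map.1 h
    exact hz i hi
  have heval := eval_iterate_derivative_prod_X_sub_C hroots k
  rw [Multiset.map_map, Multiset.map_map] at heval
  have hfact : (1 : ℝ) ≤ k.factorial := by exact_mod_cast k.factorial_pos
  calc ‖(polyOfZeros z n).eval a‖ * δ
      ≤ ‖(polyOfZeros z n).eval a‖
          * (k.factorial * ‖esymmRange (fun i => 1 / (a - z i)) n k‖) := by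
        gcongr
        exact hδ.trans (le_mul_of_one_le_left (norm_nonneg _) hfact)
    _ = ‖(derivative^[k] (polyOfZeros z n)).eval a‖ := by
        rw [← Complex.norm_natCast, ← norm_mul, ← norm_mul]
        exact congrArg norm heval.symm

theorem norm_one_div_sub_le_of_norm_eq_one {a w : ℂ} (ha : ‖a‖ < 1) (hw : ‖w‖ = 1) :
    ‖1 / (a - w)‖ ≤ 1 / (1 - ‖a‖) := by
  rw [norm_div, norm_one]
  have := norm_sub_norm_le w a
  rw [norm_sub_rev, hw] at this
  exact one_div_le_one_div_of_le (by linarith) (by linarith)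

theorem ne_of_norm_eq_one {a w : ℂ} (ha : ‖a‖ < 1) (hw : ‖w‖ = 1) : w ≠ a := by
  rintro rfl
  exact ha.ne hw

theorem eventually_le_norm_eval_iterate_derivative_of_tendsto {z : ℕ → ℂ} (hz : ∀ i, ‖z i‖ = 1)
    {a : ℂ} (ha : ‖a‖ < 1) {c : ℂ} (hc0 : c ≠ 0)
    (hc : Tendsto (fun n : ℕ => (n : ℝ)⁻¹ • ∑ i ∈ Finset.range n, 1 / (a - z i)) atTop (𝓝 c))
    (k : ℕ) :
    ∃ δ > 0, ∀ᶠ n : ℕ in atTop, ‖(polyOfZeros z n).eval a‖ * (δ / n ^ 0)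
      ≤ ‖(derivative^[k] (polyOfZeros z n)).eval a‖ := by
  have hlim := (tendsto_esymmRange_div_pow
    (fun i => norm_one_div_sub_le_of_norm_eq_one ha (hz i)) hc k).norm
  have hpos : 0 < ‖c ^ k / k.factorial‖ :=
    norm_pos_iff.2 (div_ne_zero (pow_ne_zero k hc0) (Nat.cast_ne_zero.2 k.factorial_ne_zero))
  refine ⟨‖c ^ k / k.factorial‖ / 2, half_pos hpos, ?_⟩
  filter_upwards [hlim.eventually_const_lt (half_lt_self hpos), eventually_gt_atTop 0]
    with n hn hn0
  refine le_norm_eval_iterate_derivative_polyOfZeros (fun i => ne_of_norm_eq_one ha (hz i)) ?_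
  have hn1 : (1 : ℝ) ≤ (n : ℝ) ^ k := one_le_pow₀ (by exact_mod_cast hn0)
  rw [norm_div (esymmRange _ _ _), norm_pow (n : ℂ), Complex.norm_natCast,
    lt_div_iff₀ (by positivity)] at hn
  rw [pow_zero, div_one]
  exact (le_mul_of_one_le_right (by positivity) hn1).trans hn.le

section AntiConcentration

variable {Ω : Type*} [MeasurableSpace Ω] {P : Measure Ω}

theorem indepFun_comp_of_dependsOn {ι E F : Type*} [MeasurableSpace E] [Nonempty E]
    [MeasurableSpace F] {X : ι → Ω → E} (hX : ∀ i, Measurable (X i)) (hindep : iIndepFun X P)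
    {φ : (ι → E) → F} (hφ : Measurable φ) {s : Finset ι} (hφs : DependsOn φ s) {j : ι}
    (hj : j ∉ s) : IndepFun (fun ω => φ (X · ω)) (X j) P := by
  classical
  obtain ⟨e⟩ := ‹Nonempty E›
  let ext : (s → E) → ι → E := fun v i => if hi : i ∈ s then v ⟨i, hi⟩ else e
  have hext : Measurable ext := by
    refine measurable_pi_lambda _ fun i => ?_
    by_cases hi : i ∈ s
    · simpa only [ext, dif_pos hi] using measurable_pi_apply _
    · simpa only [ext, dif_neg hi] using measurable_const
  have hcomp := (hindep.indepFun_finset s {j} (Finset.disjoint_singleton_right.2 hj) hX).comp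
    (hφ.comp hext)
    (measurable_pi_apply (X := fun _ : ({j} : Finset ι) => E) ⟨j, Finset.mem_singleton_self j⟩)
  have heq : (fun ω => φ (X · ω)) = (φ ∘ ext) ∘ fun ω (i : s) => X i ω :=
    funext fun ω => hφs fun i hi => by
      simp only [ext, dif_pos (Finset.mem_coe.1 hi)]
  rw [heq]
  exact hcomp

variable [IsProbabilityMeasure P]

theorem measure_norm_sub_lt_le_of_indepFun {E : Type*} [NormedAddCommGroup E] [MeasurableSpace E]
    [BorelSpace E] [SecondCountableTopology E] {X Y : Ω → E} (hX : Measurable X)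
    (hY : Measurable Y) (hindep : IndepFun Y X P) {t : ℝ} {b : ℝ≥0∞}
    (hb : ∀ c, P {ω | ‖X ω - c‖ < t} ≤ b) : P {ω | ‖X ω - Y ω‖ < t} ≤ b := by
  let T : Set (E × E) := {q | ‖q.2 - q.1‖ < t}
  have hT : MeasurableSet T := measurableSet_lt (by fun_prop) measurable_const
  have := Measure.isProbabilityMeasure_map (μ := P) hY.aemeasurable
  calc P {ω | ‖X ω - Y ω‖ < t} = P.map (fun ω => (Y ω, X ω)) T :=
        (Measure.map_apply (hY.prodMk hX) hT).symm
    _ = ∫⁻ c, P.map X {x | ‖x - c‖ < t} ∂P.map Y := by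
        rw [(indepFun_iff_map_prod_eq_prod_map_map hY.aemeasurable hX.aemeasurable).1 hindep,
          Measure.prod_apply hT]
        rfl
    _ ≤ ∫⁻ _, b ∂P.map Y := lintegral_mono fun c => by
        rw [Measure.map_apply hX (measurableSet_lt (by fun_prop) measurable_const)]
        exact hb c
    _ = b := by rw [lintegral_const, measure_univ, mul_one]

variable {𝕜 : Type*} [NormedField 𝕜] [MeasurableSpace 𝕜] [BorelSpace 𝕜]
  [SecondCountableTopology 𝕜] {X : ℕ → Ω → 𝕜} (hX : ∀ i, Measurable (X i))
  (hindep : iIndepFun X P)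
include hX hindep

theorem measure_norm_esymmRange_lt_le {t : ℝ} (ht : 0 < t) {b : ℝ≥0∞}
    (hb : ∀ i c, P {ω | ‖X i ω - c‖ < t} ≤ b) {n k : ℕ} (hkn : k ≤ n) :
    P {ω | ‖esymmRange (X · ω) n k‖ < t ^ k} ≤ k * b := by
  induction k generalizing n with
  | zero => simp [esymmRange_zero_right]
  | succ k ih =>
    obtain ⟨n, rfl⟩ : ∃ m, n = m + 1 := ⟨n - 1, by omega⟩
    let φ : (ℕ → 𝕜) → 𝕜 := fun x => -(esymmRange x n (k + 1) / esymmRange x n k)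
    have hφ : Measurable φ := ((continuous_esymmRange n (k + 1)).measurable.div
      (continuous_esymmRange n k).measurable).neg
    have hφn : DependsOn φ (Finset.range n) := fun x y h => by
      simp only [φ, dependsOn_esymmRange n _ h]
    have hlast : P {ω | ‖X n ω - φ (X · ω)‖ < t} ≤ b :=
      measure_norm_sub_lt_le_of_indepFun (hX n) (hφ.comp (measurable_pi_lambda _ hX))
        (indepFun_comp_of_dependsOn hX hindep hφ hφn Finset.notMem_range_self) (hb n)
    have hsub : {ω | ‖esymmRange (X · ω) (n + 1) (k + 1)‖ < t ^ (k + 1)}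
        ⊆ {ω | ‖esymmRange (X · ω) n k‖ < t ^ k} ∪ {ω | ‖X n ω - φ (X · ω)‖ < t} := by
      intro ω hω
      by_contra! hnot
      simp only [Set.mem_union, Set.mem_ofPred_eq, not_or, not_lt] at hnot hω
      have hne : esymmRange (X · ω) n k ≠ 0 := norm_pos_iff.1 ((pow_pos ht k).trans_le hnot.1)
      have hfactor : esymmRange (X · ω) (n + 1) (k + 1)
          = esymmRange (X · ω) n k * (X n ω - φ (X · ω)) := by
        rw [esymmRange_succ_succ]
        simp only [φ]
        field_simp
        ring
      rw [hfactor, norm_mul, pow_succ] at hω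
      exact hω.not_ge (mul_le_mul hnot.1 hnot.2 ht.le (norm_nonneg _))
    calc P {ω | ‖esymmRange (X · ω) (n + 1) (k + 1)‖ < t ^ (k + 1)} ≤ k * b + b :=
          (measure_mono hsub).trans ((measure_union_le _ _).trans
            (add_le_add (ih (by omega)) hlast))
      _ = (k + 1 : ℕ) * b := by rw [Nat.cast_add_one, add_mul, one_mul]

theorem ae_eventually_le_norm_esymmRange {t : ℕ → ℝ} (ht : ∀ n, 0 < t n) {b : ℕ → ℝ≥0∞}
    (hb : ∀ n i c, P {ω | ‖X i ω - c‖ < t n} ≤ b n) (hsum : ∑' n, b n ≠ ∞) (k : ℕ) :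
    ∀ᵐ ω ∂P, ∀ᶠ n in atTop, t n ^ k ≤ ‖esymmRange (X · ω) n k‖ := by
  have hle (n : ℕ) : P {ω | k ≤ n ∧ ‖esymmRange (X · ω) n k‖ < t n ^ k} ≤ k * b n := by
    by_cases hkn : k ≤ n
    · simpa only [hkn, true_and] using measure_norm_esymmRange_lt_le hX hindep (ht n) (hb n) hkn
    · simp [hkn]
  have hfin : ∑' n, P {ω | k ≤ n ∧ ‖esymmRange (X · ω) n k‖ < t n ^ k} ≠ ∞ := by
    refine ne_top_of_le_ne_top ?_ (ENNReal.tsum_le_tsum hle)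
    rw [ENNReal.tsum_mul_left]
    exact ENNReal.mul_ne_top (ENNReal.natCast_ne_top k) hsum
  filter_upwards [ae_eventually_notMem hfin] with ω hω
  filter_upwards [hω, eventually_ge_atTop k] with n hn hkn
  exact not_lt.1 fun hlt => hn ⟨hkn, hlt⟩

end AntiConcentration

section UnitCircle

theorem le_poissonKernel_of_norm_sub_le {p w : ℂ} (hp : ‖p‖ = 1) (hw : ‖w‖ = 1) {t : ℝ}
    (ht : 0 < t) (ht1 : t ≤ 1) (hwp : ‖w - p‖ ≤ t) :
    1 / (4 * t) ≤ poissonKernel 0 ((1 - t : ℝ) * p) w := by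
  set a : ℂ := (1 - t : ℝ) * p with ha_def
  have ha : ‖a‖ = 1 - t := by
    rw [norm_mul, hp, mul_one, Complex.norm_real, Real.norm_of_nonneg (by linarith)]
  have hpa : ‖p - a‖ = t := by
    rw [ha_def, ← one_sub_mul, norm_mul, hp, mul_one, ← Complex.ofReal_one,
      ← Complex.ofReal_sub, sub_sub_cancel, Complex.norm_real, Real.norm_of_nonneg ht.le]
  have hle : ‖w - a‖ ≤ 2 * t := by
    linarith [norm_sub_le_norm_sub_add_norm_sub w p a]
  have hpos : 0 < ‖w - a‖ :=
    norm_pos_iff.2 (sub_ne_zero.2 (ne_of_norm_eq_one (by linarith) hw))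
  have hnum : t ≤ 1 - (1 - t) ^ 2 := by nlinarith
  rw [poissonKernel_def, sub_zero, sub_zero, hw, ha, one_pow]
  calc 1 / (4 * t) = t / (2 * t) ^ 2 := by field_simp; norm_num
    _ ≤ (1 - (1 - t) ^ 2) / ‖w - a‖ ^ 2 :=
      div_le_div₀ (ht.le.trans hnum) hnum (by positivity) (by gcongr)

variable {μ : Measure ℂ} (hμ : ∀ᵐ w ∂μ, ‖w‖ = 1)
include hμ

theorem integrable_one_div_sub [IsFiniteMeasure μ] {a : ℂ} (ha : ‖a‖ < 1) :
    Integrable (fun w => 1 / (a - w)) μ :=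
  .of_bound
    (show Measurable fun w : ℂ => 1 / (a - w) by fun_prop).aestronglyMeasurable _
    (hμ.mono fun _ hw => norm_one_div_sub_le_of_norm_eq_one ha hw)

theorem poissonKernel_ae_eq_one_sub_re {a : ℂ} (ha : ‖a‖ < 1) :
    poissonKernel 0 a =ᵐ[μ] fun w => 1 - 2 * (a * (1 / (a - w))).re := by
  filter_upwards [hμ] with w hw
  have hne : a - w ≠ 0 := sub_ne_zero.2 (ne_of_norm_eq_one ha hw).symm
  have hherglotz : herglotzRieszKernel 0 a w = 1 - 2 * (a * (1 / (a - w))) := by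
    rw [herglotzRieszKernel_def, sub_zero, sub_zero, ← neg_sub a w]
    field_simp
    ring
  rw [poissonKernel_eq_re_herglotzRieszKernel, Function.comp_apply, hherglotz]
  simp

theorem integrable_poissonKernel [IsFiniteMeasure μ] {a : ℂ} (ha : ‖a‖ < 1) :
    Integrable (poissonKernel 0 a) μ :=
  ((integrable_const 1).sub
    (((integrable_one_div_sub hμ ha).const_mul a).re.const_mul 2)).congr
    (poissonKernel_ae_eq_one_sub_re hμ ha).symm

variable [IsProbabilityMeasure μ]

theorem integral_poissonKernel {a : ℂ} (ha : ‖a‖ < 1) :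
    ∫ w, poissonKernel 0 a w ∂μ = 1 - 2 * (a * ∫ w, 1 / (a - w) ∂μ).re := by
  have hint : Integrable (fun w => a * (1 / (a - w))) μ :=
    (integrable_one_div_sub hμ ha).const_mul a
  have hint2 : Integrable (fun w => 2 * (a * (1 / (a - w))).re) μ := hint.re.const_mul 2
  have hre : ∫ w, (a * (1 / (a - w))).re ∂μ = (∫ w, a * (1 / (a - w)) ∂μ).re := integral_re hint
  rw [integral_congr_ae (poissonKernel_ae_eq_one_sub_re hμ ha),
    integral_sub (integrable_const 1) hint2, integral_const_mul, hre,
    integral_const_mul, integral_const, probReal_univ, one_smul]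

theorem measure_closedBall_le {p : ℂ} (hp : ‖p‖ = 1)
    (h : ∀ a : ℂ, a ≠ 0 → ‖a‖ < 1 → ∫ w, 1 / (a - w) ∂μ = 0) {t : ℝ} (ht : 0 < t) :
    μ (Metric.closedBall p t) ≤ ENNReal.ofReal (4 * t) := by
  rcases le_or_gt 1 t with ht1 | ht1
  · exact prob_le_one.trans (ENNReal.one_le_ofReal.2 (by linarith))
  set a : ℂ := (1 - t : ℝ) * p
  have ha : ‖a‖ = 1 - t := by
    rw [norm_mul, hp, mul_one, Complex.norm_real, Real.norm_of_nonneg (by linarith)]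
  have ha1 : ‖a‖ < 1 := by linarith
  have hone : ∫ w, poissonKernel 0 a w ∂μ = 1 := by
    rw [integral_poissonKernel hμ ha1, h a (norm_pos_iff.1 (by linarith)) ha1]
    simp
  have hnonneg : 0 ≤ᵐ[μ] poissonKernel 0 a := hμ.mono fun w hw => by
    rw [Pi.zero_apply, poissonKernel_def, sub_zero, sub_zero, hw]
    exact div_nonneg (sub_nonneg.2 (pow_le_pow_left₀ (norm_nonneg a) ha1.le 2)) (sq_nonneg _)
  have hball : ∀ᵐ w ∂μ, w ∈ Metric.closedBall p t → 1 / (4 * t) ≤ poissonKernel 0 a w :=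
    hμ.mono fun w hw hwp =>
      le_poissonKernel_of_norm_sub_le hp hw ht ht1.le (mem_closedBall_iff_norm.1 hwp)
  have hmarkov := mul_meas_ge_le_integral_of_nonneg hnonneg (integrable_poissonKernel hμ ha1)
    (1 / (4 * t))
  rw [hone, one_div, inv_mul_le_iff₀ (by positivity), mul_one] at hmarkov
  calc μ (Metric.closedBall p t) ≤ μ {w | 1 / (4 * t) ≤ poissonKernel 0 a w} :=
        measure_mono_ae hball
    _ ≤ ENNReal.ofReal (4 * t) := by
        rw [← ofReal_measureReal, one_div]
        exact ENNReal.ofReal_le_ofReal hmarkov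

theorem measure_norm_one_div_sub_lt_le
    (h : ∀ a : ℂ, a ≠ 0 → ‖a‖ < 1 → ∫ w, 1 / (a - w) ∂μ = 0) {a : ℂ} (ha : ‖a‖ < 1) (c : ℂ)
    {t : ℝ} (ht : 0 < t) :
    μ {w | ‖1 / (a - w) - c‖ < t} ≤ ENNReal.ofReal (32 * t) := by
  by_cases hne : ∃ p : ℂ, ‖p‖ = 1 ∧ ‖1 / (a - p) - c‖ < t
  · obtain ⟨p, hp, hpc⟩ := hne
    have hsub : ∀ᵐ w ∂μ, ‖1 / (a - w) - c‖ < t → w ∈ Metric.closedBall p (8 * t) := by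
      filter_upwards [hμ] with w hw hwc
      have hw0 : a - w ≠ 0 := sub_ne_zero.2 (ne_of_norm_eq_one ha hw).symm
      have hp0 : a - p ≠ 0 := sub_ne_zero.2 (ne_of_norm_eq_one ha hp).symm
      have hfactor : w - p = (1 / (a - w) - 1 / (a - p)) * ((a - w) * (a - p)) := by
        field_simp
        ring
      have hdiff : ‖1 / (a - w) - 1 / (a - p)‖ ≤ t + t := by
        have := norm_sub_le (1 / (a - w) - c) (1 / (a - p) - c)
        rw [sub_sub_sub_cancel_right] at this
        linarith
      have hw2 : ‖a - w‖ ≤ 2 := by linarith [norm_sub_le a w]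
      have hp2 : ‖a - p‖ ≤ 2 := by linarith [norm_sub_le a p]
      rw [mem_closedBall_iff_norm, hfactor, norm_mul, norm_mul]
      calc ‖1 / (a - w) - 1 / (a - p)‖ * (‖a - w‖ * ‖a - p‖)
          ≤ (t + t) * (2 * 2) := by gcongr
        _ = 8 * t := by ring
    calc μ {w | ‖1 / (a - w) - c‖ < t} ≤ μ (Metric.closedBall p (8 * t)) := measure_mono_ae hsub
      _ ≤ ENNReal.ofReal (32 * t) :=
        (measure_closedBall_le hμ hp h (by positivity)).trans_eq (by ring_nf)
  · have hnull : μ {w | ‖1 / (a - w) - c‖ < t} = 0 :=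
      measure_mono_null (fun w hw hw1 => hne ⟨w, hw1, hw⟩) (ae_iff.1 hμ)
    rw [hnull]
    exact zero_le

end UnitCircle

section Sampling

variable {Ω : Type*} [MeasurableSpace Ω] {P : Measure Ω} {μ : Measure ℂ} {Z : ℕ → Ω → ℂ}
  (hZ : ∀ i, Measurable (Z i)) (hindep : iIndepFun Z P) (hlaw : ∀ i, P.map (Z i) = μ)
include hZ hlaw

theorem ae_forall_norm_eq_one (hμ : ∀ᵐ w ∂μ, ‖w‖ = 1) : ∀ᵐ ω ∂P, ∀ i, ‖Z i ω‖ = 1 :=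
  ae_all_iff.2 fun i => ae_of_ae_map (hZ i).aemeasurable ((hlaw i).symm ▸ hμ)

include hindep

theorem ae_tendsto_average {f : ℂ → ℂ} (hf : Measurable f) (hfi : Integrable f μ) :
    ∀ᵐ ω ∂P, Tendsto (fun n : ℕ => (n : ℝ)⁻¹ • ∑ i ∈ Finset.range n, f (Z i ω)) atTop
      (𝓝 (∫ w, f w ∂μ)) := by
  rw [← hlaw 0] at hfi
  rw [← hlaw 0, integral_map (hZ 0).aemeasurable hf.aestronglyMeasurable]
  have hident (i : ℕ) : IdentDistrib (Z i) (Z 0) P P :=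
    ⟨(hZ i).aemeasurable, (hZ 0).aemeasurable, by rw [hlaw, hlaw]⟩
  exact strong_law_ae (fun i ω => f (Z i ω)) (hfi.comp_measurable (hZ 0))
    (fun i j hij => (hindep.indepFun hij).comp hf hf) fun i => (hident i).comp hf

variable [IsProbabilityMeasure P] [IsProbabilityMeasure μ] (hμ : ∀ᵐ w ∂μ, ‖w‖ = 1)
include hμ

theorem ae_eventually_inv_pow_le_norm_esymmRange
    (h : ∀ a : ℂ, a ≠ 0 → ‖a‖ < 1 → ∫ w, 1 / (a - w) ∂μ = 0) {a : ℂ} (ha : ‖a‖ < 1) (k : ℕ) :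
    ∀ᵐ ω ∂P, ∀ᶠ n : ℕ in atTop,
      (1 / ((n : ℝ) + 1) ^ 2) ^ k ≤ ‖esymmRange (fun i => 1 / (a - Z i ω)) n k‖ := by
  have hg : Measurable fun w : ℂ => 1 / (a - w) := by fun_prop
  have hsum : Summable fun n : ℕ => 32 * (1 / ((n : ℝ) + 1) ^ 2) := by
    have := (summable_nat_add_iff 1).2 (Real.summable_one_div_nat_pow.2 one_lt_two)
    exact_mod_cast this.mul_left 32
  refine ae_eventually_le_norm_esymmRange (X := fun i ω => 1 / (a - Z i ω))
    (fun i => hg.comp (hZ i)) (hindep.comp (fun _ w => 1 / (a - w)) fun _ => hg)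
    (fun n => by positivity) (fun n i c => ?_) hsum.tsum_ofReal_ne_top k
  calc P {ω | ‖1 / (a - Z i ω) - c‖ < 1 / ((n : ℝ) + 1) ^ 2}
      = P.map (Z i) {w | ‖1 / (a - w) - c‖ < 1 / ((n : ℝ) + 1) ^ 2} :=
        (Measure.map_apply (hZ i) (measurableSet_lt (hg.sub_const c).norm measurable_const)).symm
    _ ≤ ENNReal.ofReal (32 * (1 / ((n : ℝ) + 1) ^ 2)) := by
        rw [hlaw]
        exact measure_norm_one_div_sub_lt_le hμ h ha c (by positivity)

theorem exists_ae_eventually_le_norm_eval_iterate_derivative (k : ℕ) :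
    ∃ a : ℂ, a ≠ 0 ∧ ‖a‖ < 1 ∧ ∃ p : ℕ, ∀ᵐ ω ∂P, ∃ c > 0, ∀ᶠ n : ℕ in atTop,
      ‖(polyOfZeros (Z · ω) n).eval a‖ * (c / n ^ p)
        ≤ ‖(derivative^[k] (polyOfZeros (Z · ω) n)).eval a‖ := by
  have hZ1 := ae_forall_norm_eq_one hZ hlaw hμ
  by_cases! h : ∃ a : ℂ, a ≠ 0 ∧ ‖a‖ < 1 ∧ ∫ w, 1 / (a - w) ∂μ ≠ 0
  · obtain ⟨a, ha0, ha, hc⟩ := h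
    refine ⟨a, ha0, ha, 0, ?_⟩
    filter_upwards [hZ1, ae_tendsto_average hZ hindep hlaw (f := fun w => 1 / (a - w))
      (by fun_prop) (integrable_one_div_sub hμ ha)] with ω hω hlim
    exact eventually_le_norm_eval_iterate_derivative_of_tendsto hω ha hc hlim k
  · have ha : ‖(1 / 2 : ℂ)‖ < 1 := by norm_num
    refine ⟨1 / 2, by norm_num, ha, 2 * k, ?_⟩
    filter_upwards [hZ1, ae_eventually_inv_pow_le_norm_esymmRange hZ hindep hlaw hμ h ha k]
      with ω hω hlower
    refine ⟨(1 / 4) ^ k, by positivity, ?_⟩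
    filter_upwards [hlower, eventually_ge_atTop 1] with n hn hn1
    refine le_norm_eval_iterate_derivative_polyOfZeros (fun i => ne_of_norm_eq_one ha (hω i))
      (le_trans ?_ hn)
    have hn2 : (n : ℝ) + 1 ≤ 2 * n := by
      have : (1 : ℝ) ≤ n := by exact_mod_cast hn1
      linarith
    calc (1 / 4 : ℝ) ^ k / n ^ (2 * k) = (1 / (2 * (n : ℝ)) ^ 2) ^ k := by
          rw [pow_mul, ← div_pow, mul_pow, div_div]
          norm_num
      _ ≤ (1 / ((n : ℝ) + 1) ^ 2) ^ k := by gcongr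

end Sampling

/-- The sequence of empirical measures is defined for `n ≥ k + 1`, so it is indexed by
`n = m + k + 1` with `m : ℕ`. -/
theorem theorem1 (k : ℕ) (hk : 1 ≤ k)
    (μ : ProbabilityMeasure ℂ) (hμ : (μ : Measure ℂ) (Metric.sphere (0 : ℂ) 1) = 1)
    {Ω : Type*} [MeasurableSpace Ω] (P : Measure Ω) [IsProbabilityMeasure P]
    (Z : ℕ → Ω → ℂ) (hZmeas : ∀ i, Measurable (Z i))
    (hZindep : iIndepFun Z P) (hZlaw : ∀ i, P.map (Z i) = (μ : Measure ℂ)) :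
    ∀ᵐ ω ∂P, Tendsto
      (fun m : ℕ => empiricalMeasure k (fun i => Z i ω) (m + k + 1) (by omega))
      atTop (𝓝 μ) := by
  have hsphere : ∀ᵐ w ∂(μ : Measure ℂ), w ∈ Metric.sphere (0 : ℂ) 1 :=
    (mem_ae_iff_prob_eq_one Metric.isClosed_sphere.measurableSet).2 hμ
  have hμ1 : ∀ᵐ w ∂(μ : Measure ℂ), ‖w‖ = 1 := hsphere.mono fun _ => mem_sphere_zero_iff_norm.1
  have hZ1 : ∀ᵐ ω ∂P, ∀ i, ‖Z i ω‖ = 1 := ae_forall_norm_eq_one hZmeas hZlaw hμ1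
  have hmom : ∀ᵐ ω ∂P, ∀ m : ℕ, Tendsto
      (fun n : ℕ => (n : ℝ)⁻¹ • ∑ i ∈ Finset.range n, Z i ω ^ m) atTop
      (𝓝 (∫ w, w ^ m ∂(μ : Measure ℂ))) := ae_all_iff.2 fun m =>
    ae_tendsto_average hZmeas hZindep hZlaw (f := (· ^ m)) (by fun_prop)
      (integrable_of_continuous_of_ae_mem_isCompact (isCompact_sphere 0 1) hsphere
        (continuous_pow m))
  obtain ⟨a, ha0, ha, p, hlower⟩ :=
    exists_ae_eventually_le_norm_eval_iterate_derivative hZmeas hZindep hZlaw hμ1 k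
  filter_upwards [hZ1, hmom, hlower] with ω hω hmomω ⟨c, hc, hcω⟩
  exact tendsto_empiricalMeasure hω hμ1 hmomω ha0 ha hc hcω (tendsto_add_atTop_nat (k + 1)) _
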